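/- All graphs are finite and simple. A numbering of a graph $G$ of order $n$ is a bijection $\pi\colon V(G)\to\{1,\dots,n\}$. A 2-path $\langle x,u,y\rangle$ of $G$ (with $x\neq y$ both adjacent to the middle vertex $u$; $\langle x,u,y\rangle$ and $\langle y,u,x\rangle$ are the same 2-path) is valid for $\pi$ if $\pi(u)<\min\{\pi(x),\pi(y)\}$. Let $\phi_\pi(G)$ be the number of 2-paths of $G$ that are valid for $\pi$, and let $\phi_{\min}(G)$ and $\phi_{\max}(G)$ be the minimum and the maximum of $\phi_\pi(G)$ over all numberings $\pi$ of $G$. Dimpling a triangular face of a plane graph means inserting one new vertex into the face and joining it to the three vertices of the face. An Apollonian graph is a graph obtained from $K_4$ by a finite (possibly empty) sequence of dimplings of faces; the triangle $K_3$ is also counted as the Apollonian graph of order $3$. Let $n\ge 3$. (i) Every Apollonian graph $A_n$ of order $n$ satisfies $\phi_{\min}(A_n)=3n-8$. (ii) The maximum of $\phi_{\max}(A_n)$ over all Apollonian graphs $A_n$ of order $n$ equals $$4\left(\tfrac n2-1\right)^2+\tfrac n2-2=n^2-\tfrac72 n+2\quad\text{if } n \text{ is even},\qquad 4\left\lfloor\tfrac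 n2\right\rfloor^2-3\left\lfloor\tfrac n2\right\rfloor\quad\text{if } n\text{ is odd.}$$ Moreover, the graph consisting of a path with $2$ vertices, a disjoint path with $n-2$ vertices, and all edges between the two paths (the graph "of the form $P_2\times P_{n-2}$") is an Apollonian graph of order $n$, and its $\phi_{\max}$ equals this maximum. -/

import Mathlib

namespace PathValidity

section Validity

variable {V : Type*} [Fintype V]

/-- A numbering of the vertices. The numbers are `0, …, n - 1` instead of `1, …, n`; only
their order matters for validity. -/
abbrev Numbering (V : Type*) [Fintype V] := V ≃ Fin (Fintype.card V)

/-- The valid 2-paths of `G` under the numbering `π`. The 2-path `⟨x, u, y⟩`, which is the same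
path as `⟨y, u, x⟩`, is the pair of its middle vertex `u` and the two-element set `{x, y}` of its
endpoints; it is valid if the number of `u` is smaller than the numbers of both endpoints. -/
def validPaths (G : SimpleGraph V) (π : Numbering V) : Set (V × Finset V) :=
  {p | p.2.card = 2 ∧ ∀ x ∈ p.2, G.Adj p.1 x ∧ π p.1 < π x}

/-- The validity `φ_π(G)`: the number of valid 2-paths (a finite set). -/
noncomputable def validity (G : SimpleGraph V) (π : Numbering V) : ℕ :=
  (validPaths G π).ncard

/-- The minimum validity `φ_min(G)` over all numberings (a finite nonempty set). -/
noncomputable def phiMin (G : SimpleGraph V) : ℕ := sInf (Set.range (validity G))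

/-- The maximum validity `φ_max(G)` over all numberings (a finite nonempty set). -/
noncomputable def phiMax (G : SimpleGraph V) : ℕ := sSup (Set.range (validity G))

end Validity

section Apollonian

variable {V : Type*} [DecidableEq V]

/-- The complete graph on the vertices in `S`; the vertices outside `S` are isolated. -/
def cliqueOn (S : Finset V) : SimpleGraph V :=
  SimpleGraph.fromRel fun x y => x ∈ S ∧ y ∈ S

/-- The graph `G` with the vertex `v` joined to all vertices of `t`. -/
def attach (G : SimpleGraph V) (v : V) (t : Finset V) : SimpleGraph V :=
  G ⊔ SimpleGraph.fromRel fun x y => x = v ∧ y ∈ t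

/-- `Dimpled S G F`: the graph with vertex set `S` and the edges of `G` arises from a `K₄` by a
finite sequence of face dimplings, and `F` is the resulting set of (triangular) faces, each given
by its three vertices. All four triangles of the planar graph `K₄` are faces. Dimpling a face `t`
inserts a new vertex `v` into it, joins `v` to the three vertices of `t`, and replaces `t` by the
three faces formed by `v` and two of the vertices of `t`. -/
inductive Dimpled : Finset V → SimpleGraph V → Finset (Finset V) → Prop
  | base (S : Finset V) (hS : S.card = 4) :
      Dimpled S (cliqueOn S) (S.powersetCard 3)
  | dimple (S : Finset V) (G : SimpleGraph V) (F : Finset (Finset V)) (h : Dimpled S G F)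
      (t : Finset V) (ht : t ∈ F) (v : V) (hv : v ∉ S) :
      Dimpled (insert v S) (attach G v t)
        (F.erase t ∪ (t.powersetCard 2).image fun e => insert v e)

/-- Apollonian graphs: the triangle (the degenerate case of order 3), and all graphs obtained from
`K₄` by iterated face dimpling. -/
def IsApollonian [Fintype V] (G : SimpleGraph V) : Prop :=
  (Fintype.card V = 3 ∧ G = ⊤) ∨ ∃ F : Finset (Finset V), Dimpled Finset.univ G F

end Apollonian

/-- The graph "of the form `P₂ × P_{n-2}`": the base, a path with 2 vertices, the spine, a path
with `n - 2` vertices, and all edges between the base and the spine. -/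
def baseSpine (n : ℕ) : SimpleGraph (Fin 2 ⊕ Fin (n - 2)) :=
  (SimpleGraph.pathGraph 2 ⊕g SimpleGraph.pathGraph (n - 2)) ⊔
    completeBipartiteGraph (Fin 2) (Fin (n - 2))

end PathValidity

/-!
Direct every edge towards its endpoint with the larger number. A 2-path is valid exactly when both
of its edges leave the middle vertex, so the validity is the sum of `d.choose 2` over the
out-degrees `d` (`validity_eq_sum_choose`). The out-degrees of an Apollonian graph of order `n` add
up to `3n - 6`.

*Minimum.* Since `d.choose 2 ≥ 2 * d - 3`, with equality for `d = 2` and `d = 3`, the sum of the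
out-degrees gives a lower bound, which the small out-degrees of the last two vertices improve to
`3n - 8` (`IsApollonian.le_validity`). Numbering the vertices in the reverse order of their
insertion gives out-degrees 3, …, 3, 2, 1, 0 and attains the bound
(`Dimpled.exists_sum_choose_le`).

*Maximum.* The bound is `(n - 2) ^ 2 + ⌊(n - 3) / 2⌋`. Planarity enters only through a bound
on the sum of any `k ≥ 3` out-degrees, which is at most `2n + 3k - 10`
(`Dimpled.sum_outDeg_add_card_le`).
Together with `d a + d b ≤ 2n - 3` for two vertices, it turns the upper bound into a statement about
degree sequences (`sum_choose_two_le`). If the two largest out-degrees add up to `2n - 3`, they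
contribute `(n - 2) ^ 2`, all other out-degrees are at most 2, and their sum is `n - 3`, so at most
`⌊(n - 3) / 2⌋` of them are equal to 2. Otherwise the two largest out-degrees lose so much that
convexity gives the bound `(n - 2) ^ 2 + 1`, provided that `n ≥ 6`; for `n ≤ 5` the bound is that of
the complete graph.

The graph `baseSpine n` attains the bound when the base is numbered first and then every other
vertex of the spine (`IsSpineLabelling.exists_le_validity`).
-/

namespace PathValidity

open Finset

/-! ### Validity as a sum over out-degrees -/

section OutDegree

variable {V : Type*} [Fintype V]

open Classical in
/-- The out-neighbours of `u` when every edge of `G` is directed towards its endpoint with the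
larger key. -/
noncomputable def outSet (G : SimpleGraph V) (κ : V → ℕ) (u : V) : Finset V :=
  {x | G.Adj u x ∧ κ u < κ x}

/-- The out-degree of `u` when every edge of `G` is directed towards its endpoint with the
larger key. Arbitrary keys instead of numberings are allowed, since a numbering of the final graph
is not a numbering of the intermediate graphs of its construction. -/
noncomputable def outDeg (G : SimpleGraph V) (κ : V → ℕ) (u : V) : ℕ := #(outSet G κ u)

theorem mem_outSet {G : SimpleGraph V} {κ : V → ℕ} {u x : V} :
    x ∈ outSet G κ u ↔ G.Adj u x ∧ κ u < κ x := by
  simp [outSet]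

theorem validity_eq_sum_choose (G : SimpleGraph V) (π : Numbering V) :
    validity G π = ∑ u, (outDeg G (fun x => (π x : ℕ)) u).choose 2 := by
  classical
  have h : validPaths G π = ↑(univ.biUnion fun u =>
      ((outSet G (fun x => (π x : ℕ)) u).powersetCard 2).map
        ⟨fun e => (u, e), fun _ _ h => (Prod.ext_iff.1 h).2⟩) := by
    ext ⟨u, e⟩
    simp only [validPaths, Set.mem_ofPred_eq, coe_biUnion, Set.mem_iUnion, mem_coe, mem_univ,
      mem_map, mem_powersetCard, subset_iff, mem_outSet, Fin.lt_def]
    constructor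
    · rintro ⟨h1, h2⟩
      exact ⟨u, trivial, e, ⟨h2, h1⟩, rfl⟩
    · rintro ⟨_, _, _, ⟨h2, h1⟩, h⟩
      obtain ⟨rfl, rfl⟩ := Prod.ext_iff.1 h
      exact ⟨h1, h2⟩
  rw [validity, h, Set.ncard_coe_finset, card_biUnion]
  · simp [outDeg]
  · intro u _ w _ huw
    simp only [Function.onFun, disjoint_left, mem_map]
    rintro _ ⟨_, _, rfl⟩ ⟨_, _, h⟩
    exact huw (Prod.ext_iff.1 h).1.symm

theorem exists_numbering {κ : V → ℕ} (hκ : Function.Injective κ) :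
    ∃ π : Numbering V, ∀ x y, π x < π y ↔ κ x < κ y := by
  let : LinearOrder V := LinearOrder.lift' κ hκ
  let e := Fintype.orderIsoFinOfCardEq V rfl
  exact ⟨e.symm.toEquiv, fun x y => e.symm.lt_iff_lt⟩

theorem exists_validity_eq (G : SimpleGraph V) {κ : V → ℕ} (hκ : Function.Injective κ) :
    ∃ π : Numbering V, validity G π = ∑ u, (outDeg G κ u).choose 2 := by
  obtain ⟨π, hπ⟩ := exists_numbering hκ
  refine ⟨π, ?_⟩
  rw [validity_eq_sum_choose]
  refine sum_congr rfl fun u _ => ?_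
  rw [outDeg, outDeg]
  congr 2
  ext x
  simp only [mem_outSet, ← hπ, Fin.lt_def]

theorem outDeg_add_lt (G : SimpleGraph V) (π : Numbering V) (u : V) :
    outDeg G (fun x => (π x : ℕ)) u + π u < Fintype.card V := by
  classical
  have h : outDeg G (fun x => (π x : ℕ)) u ≤ #(Ioi (π u)) := by
    refine card_le_card_of_injOn π (fun x hx => ?_) π.injective.injOn
    simpa using (mem_outSet.1 hx).2
  rw [Fin.card_Ioi] at h
  have := (π u).2
  omega

theorem outDeg_eq_zero {G : SimpleGraph V} {κ : V → ℕ} {S : Finset V}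
    (hG : ∀ x y, G.Adj x y → x ∈ S ∧ y ∈ S) {v : V} (hv : v ∉ S) : outDeg G κ v = 0 := by
  rw [outDeg, card_eq_zero, eq_empty_iff_forall_notMem]
  exact fun x hx => hv (hG _ _ (mem_outSet.1 hx).1).1

theorem outDeg_lt_card {G : SimpleGraph V} {κ : V → ℕ} {S : Finset V}
    (hG : ∀ x y, G.Adj x y → x ∈ S ∧ y ∈ S) {u : V} (hu : u ∈ S) : outDeg G κ u < #S := by
  refine card_lt_card ⟨fun x hx => (hG _ _ (mem_outSet.1 hx).1).2, fun h => ?_⟩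
  exact lt_irrefl _ (mem_outSet.1 (h hu)).2

/-- An edge between the two vertices is directed away from only one of them. -/
theorem outDeg_add_outDeg_lt {G : SimpleGraph V} {κ : V → ℕ} {S : Finset V}
    (hG : ∀ x y, G.Adj x y → x ∈ S ∧ y ∈ S) {a b : V} (ha : a ∈ S) (hb : b ∈ S)
    (hab : a ≠ b) : outDeg G κ a + outDeg G κ b + 3 ≤ 2 * #S := by
  classical
  wlog h : κ a ≤ κ b generalizing a b
  · have := this hb ha hab.symm (le_of_not_ge h)
    omega
  have h1 : outDeg G κ b + 2 ≤ #S := by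
    have : outSet G κ b ⊆ (S.erase a).erase b := fun x hx => by
      have hx := mem_outSet.1 hx
      have hxb : x ≠ b := hx.1.ne'
      have hxa : x ≠ a := by rintro rfl; omega
      simp [hxb, hxa, (hG _ _ hx.1).2]
    have := card_le_card this
    have h2 : 2 ≤ #S := by
      rw [← card_pair hab]
      exact card_le_card (by simp [insert_subset_iff, ha, hb])
    rw [card_erase_of_mem (by simp [hab.symm, hb]), card_erase_of_mem ha] at this
    unfold outDeg
    omega
  have := outDeg_lt_card (κ := κ) hG ha
  omega

end OutDegree

/-! ### Attaching a vertex -/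

section Attach

theorem cliqueOn_adj {V : Type*} {S : Finset V} {x y : V} :
    (cliqueOn S).Adj x y ↔ x ≠ y ∧ x ∈ S ∧ y ∈ S := by
  simp only [cliqueOn, SimpleGraph.fromRel_adj]
  tauto

variable {V : Type*} [DecidableEq V]

theorem attach_adj {G : SimpleGraph V} {v : V} {t : Finset V} (hv : v ∉ t) {x y : V} :
    (attach G v t).Adj x y ↔ G.Adj x y ∨ (x = v ∧ y ∈ t) ∨ (y = v ∧ x ∈ t) := by
  simp only [attach, SimpleGraph.sup_adj, SimpleGraph.fromRel_adj]
  constructor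
  · tauto
  · rintro (h | ⟨rfl, h⟩ | ⟨rfl, h⟩)
    · exact .inl h
    · exact .inr ⟨by rintro rfl; exact hv h, .inl ⟨rfl, h⟩⟩
    · exact .inr ⟨by rintro rfl; exact hv h, .inr ⟨rfl, h⟩⟩

theorem cliqueOn_insert {S : Finset V} {v : V} (hv : v ∉ S) :
    cliqueOn (insert v S) = attach (cliqueOn S) v S := by
  ext x y
  rw [attach_adj hv, cliqueOn_adj, cliqueOn_adj]
  simp only [mem_insert]
  constructor
  · rintro ⟨h, h1, h2⟩
    grind
  · rintro (h | ⟨rfl, h⟩ | ⟨rfl, h⟩) <;> grind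

theorem attach_inf_cliqueOn {G : SimpleGraph V} {S t : Finset V} {v : V} (hv : v ∉ S)
    (ht : t ⊆ S) (h : ∀ x ∈ S, G.Adj v x ↔ x ∈ t) :
    attach (G ⊓ cliqueOn S) v t = G ⊓ cliqueOn (insert v S) := by
  ext x y
  rw [attach_adj fun hh => hv (ht hh)]
  simp only [SimpleGraph.inf_adj, cliqueOn_adj, mem_insert]
  have h1 := G.adj_comm x v
  have h2 := G.adj_comm y v
  have h3 : ¬ G.Adj v v := fun h => h.ne rfl
  grind

theorem attach_adj_mem {G : SimpleGraph V} {S t : Finset V} {v : V}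
    (hG : ∀ x y, G.Adj x y → x ∈ S ∧ y ∈ S) (hv : v ∉ S) (ht : t ⊆ S) :
    ∀ x y, (attach G v t).Adj x y → x ∈ insert v S ∧ y ∈ insert v S := by
  intro x y h
  rw [attach_adj fun hh => hv (ht hh)] at h
  rcases h with h | ⟨rfl, h⟩ | ⟨rfl, h⟩
  · simp [hG _ _ h]
  · simp [ht h]
  · simp [ht h]

variable [Fintype V]

theorem outDeg_attach_self {G : SimpleGraph V} {κ : V → ℕ} {S t : Finset V} {v : V}
    (hG : ∀ x y, G.Adj x y → x ∈ S ∧ y ∈ S) (hv : v ∉ S) (ht : t ⊆ S) :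
    outDeg (attach G v t) κ v = #{x ∈ t | κ v < κ x} := by
  have hvt : v ∉ t := fun hh => hv (ht hh)
  rw [outDeg]
  congr 1
  ext x
  have : ¬ G.Adj v x := fun h => hv (hG _ _ h).1
  simp only [mem_outSet, attach_adj hvt, mem_filter]
  tauto

theorem outDeg_attach_of_ne {G : SimpleGraph V} {κ : V → ℕ} {S t : Finset V} {v u : V}
    (hG : ∀ x y, G.Adj x y → x ∈ S ∧ y ∈ S) (hv : v ∉ S) (ht : t ⊆ S) (hu : u ≠ v) :
    outDeg (attach G v t) κ u = outDeg G κ u + if u ∈ t ∧ κ u < κ v then 1 else 0 := by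
  have hvt : v ∉ t := fun hh => hv (ht hh)
  have hvu : v ∉ outSet G κ u := fun h => hv (hG _ _ (mem_outSet.1 h).1).2
  split_ifs with h
  · rw [outDeg, outDeg, ← card_insert_of_notMem hvu]
    congr 1
    ext x
    simp only [mem_outSet, attach_adj hvt, mem_insert]
    grind
  · rw [add_zero, outDeg, outDeg]
    congr 1
    ext x
    simp only [mem_outSet, attach_adj hvt]
    grind

theorem sum_outDeg_attach_of_notMem {G : SimpleGraph V} {κ : V → ℕ} {S t X : Finset V} {v : V}
    (hG : ∀ x y, G.Adj x y → x ∈ S ∧ y ∈ S) (hv : v ∉ S) (ht : t ⊆ S) (hX : v ∉ X) :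
    ∑ u ∈ X, outDeg (attach G v t) κ u =
      ∑ u ∈ X, outDeg G κ u + #{u ∈ t ∩ X | κ u < κ v} := by
  rw [sum_congr rfl fun u hu => outDeg_attach_of_ne (κ := κ) hG hv ht
    (ne_of_mem_of_not_mem hu hX), sum_add_distrib, ← card_filter]
  congr 2
  grind

theorem sum_outDeg_attach_insert {G : SimpleGraph V} {κ : V → ℕ} {S t X : Finset V} {v : V}
    (hG : ∀ x y, G.Adj x y → x ∈ S ∧ y ∈ S) (hv : v ∉ S) (ht : t ⊆ S) (hX : v ∉ X) :
    ∑ u ∈ insert v X, outDeg (attach G v t) κ u =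
      ∑ u ∈ X, outDeg G κ u + #{u ∈ t ∩ X | κ u < κ v} + #{x ∈ t | κ v < κ x} := by
  rw [sum_insert hX, sum_outDeg_attach_of_notMem hG hv ht hX, outDeg_attach_self hG hv ht]
  omega

theorem sum_outDeg_attach_insert_le {G : SimpleGraph V} {κ : V → ℕ} {S t X : Finset V} {v : V}
    (hG : ∀ x y, G.Adj x y → x ∈ S ∧ y ∈ S) (hv : v ∉ S) (ht : t ⊆ S) (hX : v ∉ X) :
    ∑ u ∈ insert v X, outDeg (attach G v t) κ u ≤ ∑ u ∈ X, outDeg G κ u + #t := by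
  rw [sum_outDeg_attach_insert hG hv ht hX, add_assoc, ← card_union_of_disjoint]
  · gcongr
    grind
  · rw [disjoint_left]
    grind

theorem sum_outDeg_attach {G : SimpleGraph V} {κ : V → ℕ} (hκ : Function.Injective κ)
    {S t : Finset V} {v : V}
    (hG : ∀ x y, G.Adj x y → x ∈ S ∧ y ∈ S) (hv : v ∉ S) (ht : t ⊆ S) :
    ∑ u ∈ insert v S, outDeg (attach G v t) κ u = ∑ u ∈ S, outDeg G κ u + #t := by
  rw [sum_outDeg_attach_insert hG hv ht hv, add_assoc, ← card_union_of_disjoint]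
  · congr 2
    ext x
    have : x ∈ t → κ x ≠ κ v := fun h h' => hv (ht (hκ h' ▸ h))
    grind
  · rw [disjoint_left]
    grind

theorem sum_outDeg_cliqueOn {κ : V → ℕ} (hκ : Function.Injective κ) (S : Finset V) :
    ∑ u ∈ S, outDeg (cliqueOn S) κ u = (#S).choose 2 := by
  induction S using Finset.induction_on with
  | empty => simp
  | insert v S hv ih =>
    rw [cliqueOn_insert hv, sum_outDeg_attach hκ (fun x y h => (cliqueOn_adj.1 h).2) hv
      Subset.rfl, ih, card_insert_of_notMem hv, Nat.choose_succ_succ' _ 1, Nat.choose_one_right,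
      add_comm]

/-- Giving the attached vertex the smallest key makes it the middle vertex of a valid 2-path for
each pair of its neighbours, and leaves all other valid 2-paths as they were. -/
theorem exists_sum_choose_attach_le {G : SimpleGraph V} {S t : Finset V} {v : V}
    (hG : ∀ x y, G.Adj x y → x ∈ S ∧ y ∈ S) (hv : v ∉ S) (ht : t ⊆ S)
    {κ : V → ℕ} (hκ : Function.Injective κ) :
    ∃ κ' : V → ℕ, Function.Injective κ' ∧ ∑ u, (outDeg (attach G v t) κ' u).choose 2 ≤
      ∑ u, (outDeg G κ u).choose 2 + (#t).choose 2 := by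
  let κ' : V → ℕ := fun u => if u = v then 0 else κ u + 1
  have hlt : ∀ x y, x ≠ v → y ≠ v → (κ' x < κ' y ↔ κ x < κ y) := by
    intro x y hx hy
    simp [κ', hx, hy]
  refine ⟨κ', fun x y h => ?_, ?_⟩
  · by_cases hx : x = v <;> by_cases hy : y = v <;> simp [κ', hx, hy] at h
    · rw [hx, hy]
    · exact hκ h
  · rw [← add_sum_erase univ _ (mem_univ v), ← add_sum_erase univ _ (mem_univ v),
      outDeg_eq_zero hG hv, outDeg_attach_self hG hv ht, add_comm, Nat.choose_zero_succ, zero_add]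
    gcongr with u hu
    · rw [outDeg_attach_of_ne hG hv ht (ne_of_mem_erase hu), if_neg (by simp [κ']), add_zero]
      refine card_le_card fun x hx => ?_
      rw [mem_outSet] at hx ⊢
      refine ⟨hx.1, (hlt u x (ne_of_mem_erase hu) ?_).1 hx.2⟩
      rintro rfl
      exact hv (hG _ _ hx.1).2
    · exact filter_subset _ _

theorem exists_sum_choose_cliqueOn_le (S : Finset V) :
    ∃ κ : V → ℕ, Function.Injective κ ∧
      ∑ u, (outDeg (cliqueOn S) κ u).choose 2 ≤ (#S).choose 3 := by
  induction S using Finset.induction_on with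
  | empty =>
    refine ⟨fun x => Fintype.equivFin V x, fun x y h => (Fintype.equivFin V).injective
      (Fin.ext h), le_of_eq (sum_eq_zero fun u _ => ?_)⟩
    rw [outDeg_eq_zero (fun x y h => (cliqueOn_adj.1 h).2) (notMem_empty u),
      Nat.choose_zero_succ]
  | insert v S hv ih =>
    obtain ⟨κ, hκ, h⟩ := ih
    obtain ⟨κ', hκ', h'⟩ := exists_sum_choose_attach_le
      (fun x y h => (cliqueOn_adj.1 h).2) hv Subset.rfl hκ
    refine ⟨κ', hκ', ?_⟩
    rw [cliqueOn_insert hv, card_insert_of_notMem hv, Nat.choose_succ_succ' _ 2,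
      show 2 + 1 = 3 from rfl]
    omega

end Attach

/-! ### Out-degrees in dimpled graphs -/

section Dimpled

variable {V : Type*} [DecidableEq V] {S : Finset V} {G : SimpleGraph V} {F : Finset (Finset V)}

theorem Dimpled.mem_face (h : Dimpled S G F) : ∀ f ∈ F, f ⊆ S ∧ #f = 3 := by
  induction h with
  | base S hS => exact fun f hf => mem_powersetCard.1 hf
  | dimple S G F h t ht v hv ih =>
    intro f hf
    rcases mem_union.1 hf with hf | hf
    · exact ⟨(ih f (mem_of_mem_erase hf)).1.trans (subset_insert _ _),
        (ih f (mem_of_mem_erase hf)).2⟩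
    · obtain ⟨e, he, rfl⟩ := mem_image.1 hf
      rw [mem_powersetCard] at he
      refine ⟨insert_subset_insert _ (he.1.trans (ih t ht).1), ?_⟩
      rw [card_insert_of_notMem fun hh => hv ((ih t ht).1 (he.1 hh)), he.2]

theorem Dimpled.adj_mem (h : Dimpled S G F) : ∀ x y, G.Adj x y → x ∈ S ∧ y ∈ S := by
  induction h with
  | base S hS => exact fun x y h => (cliqueOn_adj.1 h).2
  | dimple S G F h t ht v hv ih => exact attach_adj_mem ih hv (h.mem_face t ht).1

variable [Fintype V]

theorem Dimpled.sum_outDeg (h : Dimpled S G F) {κ : V → ℕ} (hκ : Function.Injective κ) :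
    ∑ u ∈ S, outDeg G κ u + 6 = 3 * #S := by
  induction h with
  | base S hS => rw [sum_outDeg_cliqueOn hκ, hS]; rfl
  | dimple S G F h t ht v hv ih =>
    rw [sum_outDeg_attach hκ h.adj_mem hv (h.mem_face t ht).1, card_insert_of_notMem hv,
      (h.mem_face t ht).2]
    omega

theorem Dimpled.exists_sum_choose_le (h : Dimpled S G F) :
    ∃ κ : V → ℕ, Function.Injective κ ∧ ∑ u, (outDeg G κ u).choose 2 + 8 ≤ 3 * #S := by
  induction h with
  | base S hS =>
    obtain ⟨κ, hκ, h⟩ := exists_sum_choose_cliqueOn_le S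
    rw [hS, show Nat.choose 4 3 = 4 from rfl] at h
    exact ⟨κ, hκ, by omega⟩
  | dimple S G F h t ht v hv ih =>
    obtain ⟨κ, hκ, h1⟩ := ih
    obtain ⟨κ', hκ', h2⟩ := exists_sum_choose_attach_le h.adj_mem hv (h.mem_face t ht).1 hκ
    rw [(h.mem_face t ht).2, show Nat.choose 3 2 = 3 from rfl] at h2
    rw [card_insert_of_notMem hv]
    exact ⟨κ', hκ', by omega⟩

/-- At most `2n + 3|X| - 10` edges start in a set `X` of at least three vertices, even when the
faces inside `X` are counted as well. The faces have to be included in the count for the induction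
to work: a vertex inserted into a face contained in `X` can add three edges that start in `X`, while
`2n` grows only by two, and the lost face compensates the difference. -/
theorem Dimpled.sum_outDeg_add_card_le (h : Dimpled S G F) {κ : V → ℕ}
    (hκ : Function.Injective κ) {X : Finset V} (hX : X ⊆ S) (hX3 : 3 ≤ #X) :
    ∑ u ∈ X, outDeg G κ u + #{f ∈ F | f ⊆ X} + 10 ≤ 2 * #S + 3 * #X := by
  induction h generalizing X with
  | base S hS =>
    have h1 : ∑ u ∈ X, outDeg (cliqueOn S) κ u ≤ 6 := by
      refine (sum_le_sum_of_subset hX).trans ?_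
      rw [sum_outDeg_cliqueOn hκ, hS]
      decide
    have h2 : {f ∈ S.powersetCard 3 | f ⊆ X} = X.powersetCard 3 := by
      ext f
      simp only [mem_filter, mem_powersetCard]
      exact ⟨fun h => ⟨h.2, h.1.2⟩, fun h => ⟨⟨h.1.trans hX, h.2⟩, h.1⟩⟩
    have h3 := card_le_card hX
    rw [h2, card_powersetCard, hS]
    obtain h | h : #X = 3 ∨ #X = 4 := by omega
    · rw [h, Nat.choose_self]; omega
    · rw [h, show Nat.choose 4 3 = 4 from rfl]; omega
  | dimple S G F h t ht v hv ih =>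
    obtain ⟨htS, ht3⟩ := h.mem_face t ht
    have hadj := h.adj_mem
    rw [card_insert_of_notMem hv]
    by_cases hvX : v ∈ X
    · obtain ⟨Y, hvY, rfl⟩ : ∃ Y, v ∉ Y ∧ insert v Y = X :=
        ⟨X.erase v, notMem_erase v X, insert_erase hvX⟩
      have hY : Y ⊆ S := (subset_insert_iff_of_notMem hvY).1 ((subset_insert _ _).trans hX)
      have h1 := sum_outDeg_attach_insert_le (κ := κ) hadj hv htS hvY
      have h2 : #{f ∈ F.erase t ∪ (t.powersetCard 2).image fun e => insert v e | f ⊆ insert v Y} ≤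
          #{f ∈ F.erase t | f ⊆ Y} + #((t ∩ Y).powersetCard 2) := by
        rw [filter_union]
        refine (card_union_le _ _).trans (add_le_add (card_le_card fun f hf => ?_) ?_)
        · rw [mem_filter] at hf ⊢
          refine ⟨hf.1, (subset_insert_iff_of_notMem fun hh => hv ?_).1 hf.2⟩
          exact (h.mem_face f (mem_of_mem_erase hf.1)).1 hh
        · refine (card_le_card fun f hf => ?_).trans
            (card_image_le (f := fun e => insert v e))
          obtain ⟨hf, hfY⟩ := mem_filter.1 hf
          obtain ⟨e, he, rfl⟩ := mem_image.1 hf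
          rw [mem_powersetCard] at he
          refine mem_image_of_mem _ (mem_powersetCard.2 ⟨subset_inter he.1 ?_, he.2⟩)
          exact (subset_insert_iff_of_notMem fun hh => hv (htS (he.1 hh))).1
            ((subset_insert _ _).trans hfY)
      rw [card_insert_of_notMem hvY] at hX3 ⊢
      rw [card_powersetCard] at h2
      rcases Nat.lt_or_ge 2 #Y with hY3 | hY2
      · have h3 := ih hY hY3
        by_cases htY : t ⊆ Y
        · rw [inter_eq_left.2 htY, ht3, show Nat.choose 3 2 = 3 from rfl] at h2
          have h4 : #{f ∈ F.erase t | f ⊆ Y} + 1 = #{f ∈ F | f ⊆ Y} := by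
            rw [filter_erase, card_erase_add_one (mem_filter.2 ⟨ht, htY⟩)]
          omega
        · have h4 : #{f ∈ F.erase t | f ⊆ Y} ≤ #{f ∈ F | f ⊆ Y} :=
            card_le_card (filter_subset_filter _ (erase_subset _ _))
          have h5 : #(t ∩ Y) ≤ 2 := by
            have : #(t ∩ Y) < #t := card_lt_card
              ⟨inter_subset_left, fun hh => htY fun x hx => (mem_inter.1 (hh hx)).2⟩
            omega
          have h6 := Nat.choose_le_choose 2 h5
          rw [Nat.choose_self] at h6
          omega
      · have hY2 : #Y = 2 := by omega
        obtain ⟨a, b, hab, rfl⟩ := card_eq_two.1 hY2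
        have h3 := outDeg_add_outDeg_lt (κ := κ) hadj (hY (by simp)) (hY (by simp)) hab
        have h4 : #{f ∈ F.erase t | f ⊆ {a, b}} = 0 := by
          rw [card_eq_zero, filter_eq_empty_iff]
          intro f hf hfY
          have h4 := card_le_card hfY
          have h5 := (h.mem_face f (mem_of_mem_erase hf)).2
          omega
        have h6 := Nat.choose_le_choose 2 ((card_le_card (inter_subset_right (s₁ := t))).trans
          hY2.le)
        rw [Nat.choose_self] at h6
        rw [sum_pair hab] at h1
        omega
    · have hXS : X ⊆ S := (subset_insert_iff_of_notMem hvX).1 hX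
      have h1 := sum_outDeg_attach_of_notMem (κ := κ) hadj hv htS hvX
      have h2 : #{u ∈ t ∩ X | κ u < κ v} ≤ #(t ∩ X) := card_le_card (filter_subset _ _)
      have h3 := ih hXS hX3
      have h4 : {f ∈ F.erase t ∪ (t.powersetCard 2).image fun e => insert v e | f ⊆ X} =
          {f ∈ F.erase t | f ⊆ X} := by
        rw [filter_union, union_eq_left]
        intro f hf
        obtain ⟨hf, hfX⟩ := mem_filter.1 hf
        obtain ⟨e, he, rfl⟩ := mem_image.1 hf
        exact absurd (hfX (mem_insert_self _ _)) hvX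
      rw [h4]
      by_cases htX : t ⊆ X
      · have h5 : #{f ∈ F.erase t | f ⊆ X} + 1 = #{f ∈ F | f ⊆ X} := by
          rw [filter_erase, card_erase_add_one (mem_filter.2 ⟨ht, htX⟩)]
        have h6 := card_le_card (inter_subset_left (s₁ := t) (s₂ := X))
        omega
      · have h5 : #{f ∈ F.erase t | f ⊆ X} ≤ #{f ∈ F | f ⊆ X} :=
          card_le_card (filter_subset_filter _ (erase_subset _ _))
        have h6 : #(t ∩ X) < #t := card_lt_card
          ⟨inter_subset_left, fun hh => htX fun x hx => (mem_inter.1 (hh hx)).2⟩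
        omega

end Dimpled

/-! ### Degree sequences -/

section Numeric

theorem two_mul_le_choose_two_add_three (d : ℕ) : 2 * d ≤ d.choose 2 + 3 := by
  induction d with
  | zero => simp
  | succ d ih =>
    rw [Nat.choose_succ_succ' d 1, Nat.choose_one_right, show 1 + 1 = 2 from rfl]
    rcases Nat.lt_or_ge d 2 with h | h
    · interval_cases d <;> simp
    · omega

theorem two_mul_choose_two (d : ℕ) : 2 * ((d.choose 2 : ℕ) : ℤ) = d * (d - 1) := by
  have h := Finset.sum_range_id_mul_two d
  rw [Finset.sum_range_id, ← Nat.choose_two_right] at h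
  rcases d with _ | d
  · simp
  · zify at h
    simp at h ⊢
    linarith

variable {V : Type*} [Fintype V] [DecidableEq V]

/-- Let `a` and `b` have the two largest degrees. If `d a + d b` attains its maximal value
`2n - 3`, then all other degrees are at most 2 and their sum is `n - 3`. Otherwise let
`s = 2n - 4 - d a - d b`. The amounts by which the other degrees exceed 3 have a sum of at most `s`,
which bounds their contribution by `n - 2 + s + s * d b / 2`, and the total is a convex function
of `d b`. -/
theorem sum_choose_two_le {n : ℕ} (hn : 6 ≤ n) (hV : Fintype.card V = n) (d : V → ℕ)
    (h1 : ∀ u, d u + 1 ≤ n) (h2 : ∀ a b, a ≠ b → d a + d b + 3 ≤ 2 * n)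
    (h3 : ∀ X : Finset V, 3 ≤ #X → ∑ u ∈ X, d u + 10 ≤ 2 * n + 3 * #X)
    (hsum : ∑ u, d u + 6 = 3 * n) :
    ∑ u, (d u).choose 2 ≤ (n - 2) ^ 2 + (n - 3) / 2 := by
  obtain ⟨a, -, ha⟩ := exists_max_image (univ : Finset V) d
    (card_pos.1 (by rw [card_univ]; omega))
  obtain ⟨b, hb, hbmax⟩ := exists_max_image (univ.erase a) d
    (card_pos.1 (by rw [card_erase_of_mem (mem_univ a), card_univ]; omega))
  have hba := ne_of_mem_erase hb
  set R := (univ.erase a).erase b with hR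
  have split : ∀ g : V → ℕ, ∑ u, g u = g a + g b + ∑ u ∈ R, g u := fun g => by
    rw [← add_sum_erase univ g (mem_univ a), ← add_sum_erase _ g hb, add_assoc]
  have hRb : ∀ c ∈ R, d c ≤ d b := fun c hc => hbmax c (mem_of_mem_erase hc)
  have hda := h1 a
  have hdab := ha b (mem_univ b)
  have hRT : ∀ T ⊆ R, T.Nonempty → d a + d b + ∑ u ∈ T, d u + 4 ≤ 2 * n + 3 * #T := by
    intro T hT hne
    have hbT : b ∉ T := fun h => notMem_erase b _ (hT h)
    have haT : a ∉ insert b T := by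
      rw [mem_insert, not_or]
      exact ⟨hba.symm, fun h => notMem_erase a _ (mem_of_mem_erase (hT h))⟩
    have hpos := hne.card_pos
    have h := h3 (insert a (insert b T)) (by
      rw [card_insert_of_notMem haT, card_insert_of_notMem hbT]; omega)
    rw [card_insert_of_notMem haT, card_insert_of_notMem hbT, sum_insert haT,
      sum_insert hbT] at h
    omega
  rw [split] at hsum ⊢
  have ca := two_mul_choose_two (d a)
  have cb := two_mul_choose_two (d b)
  by_cases hs : d a + d b + 3 = 2 * n
  · have hR2 : ∀ c ∈ R, d c ≤ 2 := fun c hc => by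
      have h := hRT {c} (singleton_subset_iff.2 hc) (singleton_nonempty c)
      rw [sum_singleton, card_singleton] at h
      omega
    have hle : 2 * ∑ u ∈ R, (d u).choose 2 ≤ ∑ u ∈ R, d u := by
      rw [mul_sum]
      refine sum_le_sum fun c hc => ?_
      have := hR2 c hc
      interval_cases d c <;> decide
    have e1 : d a = n - 1 := by omega
    have e2 : d b = n - 2 := by omega
    obtain ⟨k, rfl⟩ : ∃ k, n = k + 2 := ⟨n - 2, by omega⟩
    have e : (d a).choose 2 + (d b).choose 2 = k ^ 2 := by
      replace e1 : (d a : ℤ) = k + 1 := by omega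
      replace e2 : (d b : ℤ) = k := by omega
      rw [e1] at ca
      rw [e2] at cb
      zify
      linarith
    rw [e, Nat.add_sub_cancel]
    omega
  · have hs : d a + d b + 4 ≤ 2 * n := by have := h2 a b hba.symm; omega
    obtain ⟨s, hs⟩ := Nat.exists_eq_add_of_le hs
    -- The total excess over degree 3 outside `a` and `b` is at most `s`.
    have hex : ∑ u ∈ R with 3 < d u, ((d u : ℤ) - 3) ≤ s := by
      rw [sum_sub_distrib, sum_const, nsmul_eq_mul]
      rcases (R.filter (3 < d ·)).eq_empty_or_nonempty with h | h
      · rw [h]; simp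
      · have := hRT _ (filter_subset _ _) h
        rw [← Nat.cast_sum]
        omega
    have hpt : ∀ u ∈ R, 2 * (((d u).choose 2 : ℕ) : ℤ) ≤
        2 * d u + if 3 < d u then (d b : ℤ) * ((d u : ℤ) - 3) else 0 := by
      intro u hu
      rw [two_mul_choose_two]
      have hub : (d u : ℤ) ≤ d b := by exact_mod_cast hRb u hu
      split_ifs with h
      · have : (3 : ℤ) < d u := by exact_mod_cast h
        nlinarith
      · have : (d u : ℤ) ≤ 3 := by exact_mod_cast not_lt.1 h
        nlinarith [Int.natCast_nonneg (d u)]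
    have hR' : 2 * ∑ u ∈ R, (((d u).choose 2 : ℕ) : ℤ) ≤
        2 * ∑ u ∈ R, (d u : ℤ) + d b * s := by
      rw [mul_sum]
      refine (sum_le_sum hpt).trans ?_
      rw [sum_add_distrib, ← mul_sum, ← sum_filter, ← mul_sum]
      gcongr
    have key : ((d a).choose 2 + (d b).choose 2 + ∑ u ∈ R, (d u).choose 2 : ℤ) ≤
        ((n : ℤ) - 2) ^ 2 + 1 := by
      -- `p` is the amount by which `d a` falls short of its maximal value `n - 1`.
      obtain ⟨p, hp⟩ := Nat.exists_eq_add_of_le hda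
      zify at hp hs hsum hdab hn
      have hda' : (d a : ℤ) = n - 1 - p := by linarith
      have hdb' : (d b : ℤ) = n - 3 - s + p := by linarith
      have hsum' : ∑ u ∈ R, (d u : ℤ) = n - 2 + s := by linarith
      rw [hda'] at ca
      rw [hdb'] at cb
      rw [hsum', hdb'] at hR'
      have hp0 : (0 : ℤ) ≤ p := by positivity
      have hs0 : (0 : ℤ) ≤ s := by positivity
      have hps : 0 ≤ (s : ℤ) + 2 - 2 * p := by linarith
      push_cast
      linarith [mul_nonneg hp0 hps, mul_nonneg hs0 (sub_nonneg.2 hn)]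
    obtain ⟨k, rfl⟩ : ∃ k, n = k + 2 := ⟨n - 2, by omega⟩
    have : (d a).choose 2 + (d b).choose 2 + ∑ u ∈ R, (d u).choose 2 ≤ k ^ 2 + 1 := by
      zify
      push_cast at key
      linarith
    rw [Nat.add_sub_cancel]
    omega

end Numeric

/-! ### Bounds for the validity of Apollonian graphs -/

section Bounds

theorem cliqueOn_univ {V : Type*} [Fintype V] : cliqueOn (univ : Finset V) = ⊤ := by
  ext x y
  simp [cliqueOn_adj]

variable {V : Type*} [Fintype V] [DecidableEq V] {G : SimpleGraph V} {n : ℕ}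

theorem IsApollonian.sum_outDeg (hG : IsApollonian G) {κ : V → ℕ} (hκ : Function.Injective κ) :
    ∑ u, outDeg G κ u + 6 = 3 * Fintype.card V := by
  rcases hG with ⟨hV, rfl⟩ | ⟨F, h⟩
  · rw [← cliqueOn_univ, sum_outDeg_cliqueOn hκ, card_univ, hV]
    rfl
  · exact h.sum_outDeg hκ

theorem IsApollonian.exists_validity_le (hG : IsApollonian G) :
    ∃ π : Numbering V, validity G π + 8 ≤ 3 * Fintype.card V := by
  rcases hG with ⟨hV, rfl⟩ | ⟨F, h⟩
  · obtain ⟨κ, hκ, h⟩ := exists_sum_choose_cliqueOn_le (univ : Finset V)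
    obtain ⟨π, hπ⟩ := exists_validity_eq (cliqueOn univ) hκ
    rw [← hπ, card_univ, hV, Nat.choose_self, cliqueOn_univ] at h
    exact ⟨π, by omega⟩
  · obtain ⟨κ, hκ, h⟩ := h.exists_sum_choose_le
    obtain ⟨π, hπ⟩ := exists_validity_eq G hκ
    exact ⟨π, by rwa [hπ]⟩

/-- Each out-degree `d` satisfies `d.choose 2 ≥ 2 * d - 3`, and this is improved by 3 and by 1 for
the vertices with the largest and the second largest number, whose out-degrees are 0 and at
most 1. -/
theorem IsApollonian.le_validity (hG : IsApollonian G) (hV : 3 ≤ Fintype.card V)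
    (π : Numbering V) : 3 * Fintype.card V ≤ validity G π + 8 := by
  have hsum := hG.sum_outDeg (κ := fun x => (π x : ℕ)) (Fin.val_injective.comp π.injective)
  have hlt := outDeg_add_lt G π
  rw [validity_eq_sum_choose]
  set d := outDeg G fun x => (π x : ℕ)
  let z := π.symm ⟨Fintype.card V - 1, by omega⟩
  let y := π.symm ⟨Fintype.card V - 2, by omega⟩
  have hz : (π z : ℕ) = Fintype.card V - 1 := by simp [z]
  have hy : (π y : ℕ) = Fintype.card V - 2 := by simp [y]
  have hzy : z ≠ y := by
    intro h
    rw [h] at hz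
    omega
  have hpt : ∀ u, (2 * d u + if u = z then 3 else 0) + (if u = y then 1 else 0) ≤
      (d u).choose 2 + 3 := by
    intro u
    have h := hlt u
    by_cases huz : u = z
    · rw [huz] at h ⊢
      have : d z = 0 := by omega
      simp [this, hzy]
    · by_cases huy : u = y
      · rw [huy] at h ⊢
        have : d y ≤ 1 := by omega
        simp only [hzy.symm, if_false, if_true]
        omega
      · simpa [huz, huy] using two_mul_le_choose_two_add_three (d u)
  have h := sum_le_sum fun u (_ : u ∈ univ) => hpt u
  simp only [sum_add_distrib, sum_ite_eq', mem_univ, if_true, ← mul_sum, sum_const, card_univ,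
    smul_eq_mul] at h
  omega

theorem IsApollonian.validity_le (hG : IsApollonian G) (hn : 3 ≤ n) (hV : Fintype.card V = n)
    (π : Numbering V) : validity G π ≤ (n - 2) ^ 2 + (n - 3) / 2 := by
  have hlt := outDeg_add_lt G π
  have hκ : Function.Injective fun x => (π x : ℕ) := Fin.val_injective.comp π.injective
  have hsum := hG.sum_outDeg hκ
  rw [validity_eq_sum_choose]
  rcases Nat.lt_or_ge n 6 with h6 | h6
  · calc
      _ ≤ ∑ u, (Fintype.card V - 1 - (π u : ℕ)).choose 2 := by
        gcongr with u
        have := hlt u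
        omega
      _ = ∑ i ∈ range n, (n - 1 - i).choose 2 := by
        rw [Equiv.sum_comp π fun i => (Fintype.card V - 1 - (i : ℕ)).choose 2,
          Fin.sum_univ_eq_sum_range fun i => (Fintype.card V - 1 - i).choose 2, hV]
      _ ≤ _ := by interval_cases n <;> decide
  · rcases hG with ⟨hV3, -⟩ | ⟨F, h⟩
    · omega
    · have hadj := h.adj_mem
      refine sum_choose_two_le h6 hV _ (fun u => ?_) (fun a b hab => ?_) (fun X hX => ?_) ?_
      · have := hlt u
        omega
      · have := outDeg_add_outDeg_lt (κ := fun x => (π x : ℕ)) hadj (mem_univ a) (mem_univ b) hab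
        rwa [show #(univ : Finset V) = n from hV] at this
      · have := h.sum_outDeg_add_card_le hκ (subset_univ X) hX
        rw [show #(univ : Finset V) = n from hV] at this
        omega
      · rw [hsum, hV]

theorem IsApollonian.phiMin_add (hG : IsApollonian G) (hV : 3 ≤ Fintype.card V) :
    phiMin G + 8 = 3 * Fintype.card V := by
  obtain ⟨π, hπ⟩ := hG.exists_validity_le
  have h1 := hG.le_validity hV π
  have h : IsLeast (Set.range (validity G)) (validity G π) :=
    ⟨⟨π, rfl⟩, by rintro _ ⟨σ, rfl⟩; have := hG.le_validity hV σ; omega⟩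
  rw [phiMin, h.csInf_eq]
  omega

theorem IsApollonian.phiMax_le (hG : IsApollonian G) (hn : 3 ≤ n) (hV : Fintype.card V = n) :
    phiMax G ≤ (n - 2) ^ 2 + (n - 3) / 2 :=
  csSup_le ⟨_, (Fintype.equivFin V), rfl⟩ (by rintro _ ⟨σ, rfl⟩; exact hG.validity_le hn hV σ)

theorem IsApollonian.phiMax_eq (hG : IsApollonian G) (hn : 3 ≤ n) (hV : Fintype.card V = n)
    {π : Numbering V} (hπ : (n - 2) ^ 2 + (n - 3) / 2 ≤ validity G π) :
    phiMax G = (n - 2) ^ 2 + (n - 3) / 2 := by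
  refine (hG.phiMax_le hn hV).antisymm
    (hπ.trans (le_csSup ⟨(n - 2) ^ 2 + (n - 3) / 2, ?_⟩ ⟨π, rfl⟩))
  rintro _ ⟨σ, rfl⟩
  exact hG.validity_le hn hV σ

end Bounds

/-! ### The graph with a base and a spine -/

section BaseSpine

variable {V : Type*} {G : SimpleGraph V} {n : ℕ}

/-- A labelling of `G` by `0, …, n - 1` which shows that `G` is isomorphic to `baseSpine n`: the
labels 0 and 1 belong to the base and the labels from 2 on run along the spine. -/
def IsSpineLabelling (G : SimpleGraph V) (n : ℕ) (e : V ≃ Fin n) : Prop :=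
  ∀ x y, (e x : ℕ) < e y → (G.Adj x y ↔ (e x : ℕ) < 2 ∨ (e x : ℕ) + 1 = e y)

theorem exists_isSpineLabelling (hn : 3 ≤ n) (f : G ≃g baseSpine n) :
    ∃ e : V ≃ Fin n, IsSpineLabelling G n e := by
  let g : Fin 2 ⊕ Fin (n - 2) ≃ Fin n := finSumFinEquiv.trans (finCongr (by omega))
  refine ⟨f.toEquiv.trans g, fun x y h => ?_⟩
  rw [← f.map_adj_iff]
  change (g (f x) : ℕ) < g (f y) at h
  change _ ↔ (g (f x) : ℕ) < 2 ∨ (g (f x) : ℕ) + 1 = g (f y)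
  generalize f x = a at *
  generalize f y = b at *
  rcases a with a | a <;> rcases b with b | b <;>
    simp [g, baseSpine, SimpleGraph.pathGraph_adj] at h ⊢ <;> omega

namespace IsSpineLabelling

variable {e : V ≃ Fin n}

theorem adj_iff (h : IsSpineLabelling G n e) (x y : V) : G.Adj x y ↔ (e x : ℕ) ≠ e y ∧
    ((e x : ℕ) < 2 ∨ (e y : ℕ) < 2 ∨ (e x : ℕ) + 1 = e y ∨ (e y : ℕ) + 1 = e x) := by
  rcases lt_trichotomy (e x : ℕ) (e y) with hlt | heq | hgt
  · rw [h x y hlt]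
    omega
  · obtain rfl := e.injective (Fin.ext heq)
    simp
  · rw [G.adj_comm, h y x hgt]
    omega

variable [Fintype V]

theorem card_filter_label (e : V ≃ Fin n) (p : ℕ → Prop) [DecidablePred p] :
    #{x : V | p (e x)} = #{i ∈ range n | p i} := by
  refine card_nbij (fun x => (e x : ℕ)) (fun x hx => ?_) (fun x _ y _ h => ?_) fun i hi => ?_
  · simpa using hx
  · exact e.injective (Fin.ext h)
  · obtain ⟨h1, h2⟩ := mem_filter.1 hi
    exact ⟨e.symm ⟨i, mem_range.1 h1⟩, by simpa using h2, by simp⟩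

/-- In the numbering, the base comes first, followed by the spine vertices with odd labels and then
by those with even labels. A spine vertex with an odd label, unless it is an end of the spine, is
thus the middle vertex of the valid 2-path formed with its two neighbours on the spine. -/
theorem exists_le_validity (h : IsSpineLabelling G n e) (hn : 3 ≤ n) :
    ∃ π : Numbering V, (n - 2) ^ 2 + (n - 3) / 2 ≤ validity G π := by
  let κ : V → ℕ := fun x => if 2 ≤ (e x : ℕ) ∧ (e x : ℕ) % 2 = 0 then e x + n else e x
  have hκ : Function.Injective κ := by
    intro x y hxy
    apply e.injective
    ext
    have := (e x).2
    have := (e y).2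
    grind
  obtain ⟨π, hπ⟩ := exists_validity_eq G hκ
  refine ⟨π, hπ ▸ ?_⟩
  -- `c i` is a lower bound for the number of valid 2-paths with the middle vertex labelled `i`.
  let c : ℕ → ℕ := fun i => (if i = 0 then (n - 1).choose 2 else 0) +
    (if i = 1 then (n - 2).choose 2 else 0) + if 3 ≤ i ∧ i % 2 = 1 ∧ i + 2 ≤ n then 1 else 0
  have hdeg : ∀ (u : V) (p : ℕ → Prop) [DecidablePred p],
      (∀ x, p (e x) → G.Adj u x ∧ κ u < κ x) →
      (#{i ∈ range n | p i}).choose 2 ≤ (outDeg G κ u).choose 2 := by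
    intro u p _ hp
    rw [← card_filter_label e p]
    exact Nat.choose_le_choose 2 (card_le_card fun x hx =>
      mem_outSet.2 (hp x (mem_filter.1 hx).2))
  have hc : ∀ u, c (e u) ≤ (outDeg G κ u).choose 2 := by
    intro u
    have hun := (e u).2
    by_cases h0 : (e u : ℕ) = 0
    · have h1 := hdeg u (1 ≤ ·) fun x hx => ⟨(h.adj_iff _ _).2 (by omega), by grind⟩
      have h2 : {i ∈ range n | 1 ≤ i} = Ico 1 n := by
        ext i
        simp [and_comm]
      rw [h2, Nat.card_Ico] at h1
      simpa [c, h0] using h1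
    by_cases h1 : (e u : ℕ) = 1
    · have h1' := hdeg u (2 ≤ ·) fun x hx => ⟨(h.adj_iff _ _).2 (by omega), by grind⟩
      have h2 : {i ∈ range n | 2 ≤ i} = Ico 2 n := by
        ext i
        simp [and_comm]
      rw [h2, Nat.card_Ico] at h1'
      simpa [c, h1] using h1'
    by_cases h2 : 3 ≤ (e u : ℕ) ∧ (e u : ℕ) % 2 = 1 ∧ (e u : ℕ) + 2 ≤ n
    · have h3 := hdeg u (fun i => i + 1 = e u ∨ i = e u + 1) fun x hx =>
        ⟨(h.adj_iff _ _).2 (by omega), by grind⟩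
      have h4 : {i ∈ range n | i + 1 = (e u : ℕ) ∨ i = (e u : ℕ) + 1} =
          {(e u : ℕ) - 1, (e u : ℕ) + 1} := by
        ext i
        simp only [mem_filter, mem_range, mem_insert, mem_singleton]
        omega
      rw [h4, card_pair (by omega), Nat.choose_self] at h3
      simp only [c, h0, h1, h2, if_false]
      simpa using h3
    · simp [c, h0, h1, h2]
  have hcard : (n - 3) / 2 ≤ #{i ∈ range n | 3 ≤ i ∧ i % 2 = 1 ∧ i + 2 ≤ n} := by
    rw [← card_range ((n - 3) / 2)]
    refine card_le_card_of_injOn (fun i => 2 * i + 3) (fun i hi => ?_) fun i _ j _ hij => ?_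
    · simp only [coe_range, Set.mem_Iio] at hi
      simp only [coe_filter, mem_range, Set.mem_ofPred_eq]
      omega
    · dsimp only at hij
      omega
  calc (n - 2) ^ 2 + (n - 3) / 2
      ≤ (n - 1).choose 2 + (n - 2).choose 2 +
          #{i ∈ range n | 3 ≤ i ∧ i % 2 = 1 ∧ i + 2 ≤ n} := by
        refine add_le_add (le_of_eq ?_) hcard
        obtain ⟨m, rfl⟩ : ∃ m, n = m + 2 := ⟨n - 2, by omega⟩
        rw [show m + 2 - 1 = m + 1 by omega, Nat.add_sub_cancel]
        have h1 := two_mul_choose_two (m + 1)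
        have h2 := two_mul_choose_two m
        push_cast at h1
        zify
        linarith
    _ = ∑ i ∈ range n, c i := by
        simp only [c, sum_add_distrib, sum_ite_eq', mem_range, card_filter]
        rw [if_pos (by omega), if_pos (by omega)]
    _ = ∑ u, c (e u) := by
        rw [Equiv.sum_comp e fun i => c i, Fin.sum_univ_eq_sum_range]
    _ ≤ ∑ u, (outDeg G κ u).choose 2 := sum_le_sum fun u _ => hc u

variable [DecidableEq V]

/-- The vertices with the first `k` labels arise from the first four by dimpling faces that consist
of the base and the last spine vertex. -/
theorem exists_dimpled (h : IsSpineLabelling G n e) {k : ℕ} (hk : 4 ≤ k) (hkn : k ≤ n) :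
    ∃ F : Finset (Finset V), Dimpled {x | (e x : ℕ) < k} (G ⊓ cliqueOn {x | (e x : ℕ) < k}) F ∧
      ({x | (e x : ℕ) < 2 ∨ (e x : ℕ) + 1 = k} : Finset V) ∈ F := by
  have hface : ∀ k, 4 ≤ k → k ≤ n → #{x : V | (e x : ℕ) < 2 ∨ (e x : ℕ) + 1 = k} = 3 := by
    intro k hk hkn
    rw [card_filter_label e fun i => i < 2 ∨ i + 1 = k]
    have : {i ∈ range n | i < 2 ∨ i + 1 = k} = {0, 1, k - 1} := by
      ext i
      simp only [mem_filter, mem_range, mem_insert, mem_singleton]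
      omega
    rw [this]
    exact card_eq_three.2 ⟨0, 1, k - 1, by omega, by omega, by omega, rfl⟩
  induction k, hk using Nat.le_induction with
  | base =>
    have hS : #{x : V | (e x : ℕ) < 4} = 4 := by
      rw [card_filter_label e fun i => i < 4]
      have : {i ∈ range n | i < 4} = range 4 := by
        ext i
        simp only [mem_filter, mem_range]
        omega
      rw [this, card_range]
    have hle : cliqueOn ({x | (e x : ℕ) < 4} : Finset V) ≤ G := by
      intro x y hxy
      rw [cliqueOn_adj, mem_filter_univ, mem_filter_univ] at hxy
      have h1 : (e x : ℕ) ≠ e y := fun hh => hxy.1 (e.injective (Fin.ext hh))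
      rw [h.adj_iff]
      omega
    rw [inf_eq_right.2 hle]
    refine ⟨_, .base _ hS, mem_powersetCard.2 ⟨fun x hx => ?_, hface 4 le_rfl hkn⟩⟩
    rw [mem_filter_univ] at hx ⊢
    omega
  | succ k hk ih =>
    obtain ⟨F, hF, ht⟩ := ih (by omega)
    let v : V := e.symm ⟨k, hkn⟩
    have hev : ∀ x, x = v ↔ (e x : ℕ) = k := fun x => by
      rw [← e.apply_eq_iff_eq, Fin.ext_iff]
      simp [v]
    have hv : v ∉ ({x | (e x : ℕ) < k} : Finset V) := by simp [v]
    have h1 := hF.dimple _ _ _ _ ht v hv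
    rw [attach_inf_cliqueOn hv] at h1
    · have h2 : insert v ({x | (e x : ℕ) < k} : Finset V) =
          ({x | (e x : ℕ) < k + 1} : Finset V) := by
        ext x
        simp only [mem_insert, mem_filter_univ, hev]
        omega
      have h3 : ({x | (e x : ℕ) < 2 ∨ (e x : ℕ) + 1 = k + 1} : Finset V) =
          insert v ({x | (e x : ℕ) < 2} : Finset V) := by
        ext x
        simp only [mem_insert, mem_filter_univ, hev]
        omega
      rw [h2] at h1
      refine ⟨_, h1, mem_union_right _ ?_⟩
      rw [h3]
      refine mem_image_of_mem _ (mem_powersetCard.2 ⟨fun x hx => ?_, ?_⟩)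
      · rw [mem_filter_univ] at hx ⊢
        exact .inl hx
      · have h4 := hface (k + 1) (by omega) hkn
        rw [h3, card_insert_of_notMem (by simp [v]; omega)] at h4
        omega
    · intro x hx
      rw [mem_filter_univ] at hx ⊢
      omega
    · intro x hx
      have h2 := (hev v).1 rfl
      rw [mem_filter_univ] at hx ⊢
      rw [h.adj_iff]
      omega

theorem isApollonian (h : IsSpineLabelling G n e) (hn : 3 ≤ n) : IsApollonian G := by
  have hV : Fintype.card V = n := by simpa using Fintype.card_congr e
  rcases hn.eq_or_lt with rfl | hn
  · refine .inl ⟨hV, ?_⟩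
    ext x y
    have h1 : (e x : ℕ) ≠ e y ↔ x ≠ y := by rw [← e.injective.ne_iff, ne_eq, ne_eq, Fin.ext_iff]
    rw [h.adj_iff, SimpleGraph.top_adj, ← h1]
    omega
  · obtain ⟨F, hF, -⟩ := h.exists_dimpled hn le_rfl
    have : ({x | (e x : ℕ) < n} : Finset V) = univ := by simp
    rw [this, cliqueOn_univ, inf_top_eq] at hF
    exact .inr ⟨F, hF⟩

end IsSpineLabelling

end BaseSpine

end PathValidity

theorem lemma7 {V : Type*} [Fintype V] [DecidableEq V] (n : ℕ) (hn : 3 ≤ n)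
    (hV : Fintype.card V = n) :
    (∀ G : SimpleGraph V, PathValidity.IsApollonian G →
      (PathValidity.phiMin G : ℤ) = 3 * (n : ℤ) - 8) ∧
    (∃ M : ℕ,
      IsGreatest {k : ℕ | ∃ G : SimpleGraph V,
        PathValidity.IsApollonian G ∧ PathValidity.phiMax G = k} M ∧
      (Even n →
        (M : ℚ) = 4 * ((n : ℚ) / 2 - 1) ^ 2 + (n : ℚ) / 2 - 2 ∧
        (M : ℚ) = (n : ℚ) ^ 2 - 7 / 2 * (n : ℚ) + 2) ∧
      (Odd n →
        (M : ℤ) = 4 * ((n / 2 : ℕ) : ℤ) ^ 2 - 3 * ((n / 2 : ℕ) : ℤ)) ∧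
      (∀ G : SimpleGraph V, Nonempty (G ≃g PathValidity.baseSpine n) →
        PathValidity.IsApollonian G ∧ PathValidity.phiMax G = M)) := by
  have hspine : ∀ G : SimpleGraph V, Nonempty (G ≃g PathValidity.baseSpine n) →
      PathValidity.IsApollonian G ∧ PathValidity.phiMax G = (n - 2) ^ 2 + (n - 3) / 2 := by
    rintro G ⟨f⟩
    obtain ⟨e, he⟩ := PathValidity.exists_isSpineLabelling hn f
    obtain ⟨π, hπ⟩ := he.exists_le_validity hn
    exact ⟨he.isApollonian hn, (he.isApollonian hn).phiMax_eq hn hV hπ⟩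
  refine ⟨fun G hG => ?_, (n - 2) ^ 2 + (n - 3) / 2, ⟨?_, ?_⟩, ?_, ?_, hspine⟩
  · have := hG.phiMin_add (hV ▸ hn)
    omega
  · let g : V ≃ Fin 2 ⊕ Fin (n - 2) := Fintype.equivOfCardEq (by simp; omega)
    exact ⟨_, hspine _ ⟨SimpleGraph.Iso.comap g (PathValidity.baseSpine n)⟩⟩
  · rintro _ ⟨G, hG, rfl⟩
    exact hG.phiMax_le hn hV
  · rintro ⟨k, rfl⟩
    obtain ⟨m, rfl⟩ : ∃ m, k = m + 2 := ⟨k - 2, by omega⟩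
    have e1 : m + 2 + (m + 2) - 2 = 2 * m + 2 := by omega
    have e2 : (m + 2 + (m + 2) - 3) / 2 = m := by omega
    rw [e1, e2]
    push_cast
    constructor <;> ring
  · rintro ⟨k, rfl⟩
    obtain ⟨m, rfl⟩ : ∃ m, k = m + 1 := ⟨k - 1, by omega⟩
    have e1 : 2 * (m + 1) + 1 - 2 = 2 * m + 1 := by omega
    have e2 : (2 * (m + 1) + 1 - 3) / 2 = m := by omega
    have e3 : (2 * (m + 1) + 1) / 2 = m + 1 := by omega
    rw [e1, e2, e3]
    push_cast
    ring
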